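/- Let $G=(V,E)$ be a finite connected simple graph with $|V|=n+1$, let $c:E\to\mathbb{R}_{\ge 0}$ be edge capacities, and orient every edge, writing $s(u,w)=-s(w,u)=\pm1$, with $s(u,w)=1$ if $(u,w)$ is the positive direction of its edge. A configuration assigns to every directed edge $(u,w)$ a number $\omega(u,w)\ge 0$ with $\omega(u,w)+\omega(w,u)=c(uw)$. A transaction of size $k$ from $x$ to $y$ succeeds in $\omega$ if there is a flow $f\ge 0$ of value $k$ from $x$ to $y$ with $f(u,w)\le\omega(u,w)$ for all directed edges, and fails otherwise. Let $D:E\to\mathbb{R}^n$ be a spanning representation: the direction $D(p)=\sum_{i} s(u_i,u_{i+1})D(u_iu_{i+1})$ of a walk $p=(u_0,\dots,u_r)$ is $0$ if and only if $p$ is closed, and for every spanning tree the vectors $D(e)$ of its edges span $\mathbb{R}^n$. Assume also that $D$ maps the edges of some spanning tree to the standard basis. The score of a configuration is $S(\omega)=\sum_{s(u,w)=1}\omega(u,w)D(uw)$; let $Z\subset\mathbb{R}^n$ be the set of scores of all configurations. For capacities $b$, let $Z(b)=\{\sum_{e}t_e\,b(e)D(e): t_e\in[0,1]\}$ be the zonotope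 of the network, let $\Gamma(b)=\sum_T\prod_{e\in T}b(e)$, summed over the spanning trees $T$ of $G$, and let $\Gamma_{x=y}(b)$ be the same sum for the multigraph obtained from $G$ by identifying $x$ with $y$. **Theorem.** Let $xy\in E$, $0\le k\le c(xy)$, and let $v=kD(p)$ for some walk $p$ from $x$ to $y$. Let $c'=c$ except that $c'(xy)=c(xy)-k$. Let $R$ be the set of scores of the configurations in which the transaction of size $k$ from $x$ to $y$ succeeds, and $F$ the set of scores of those in which it fails. Then 1. $R=Z\cap\{z: z-v\in Z\}$, and this set is the zonotope $Z(c')$ of the network with reduced capacity, up to a translation: $R=Z(c')$ if $s(x,y)=-1$, and $R=v+Z(c')$ if $s(x,y)=1$; 2. $\operatorname{vol}(R)=\Gamma(c')$; 3. $\operatorname{vol}(F)=k\,\Gamma_{x=y}(c)$. -/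

import Mathlib

/-! ### Spanning trees of multigraphs and their generating polynomial -/

namespace MultiGraph

variable {α β : Type*}

/-- Two vertices of a multigraph are joined by a walk. -/
def Reachable (H : Graph α β) (u v : α) : Prop :=
  Relation.ReflTransGen H.Adj u v

/-- A multigraph is connected: it has a vertex, and any two vertices are joined by a walk. -/
def IsConnected (H : Graph α β) : Prop :=
  H.vertexSet.Nonempty ∧ ∀ u ∈ H.vertexSet, ∀ v ∈ H.vertexSet, Reachable H u v

/-- A multigraph has no cycles (in particular no loops and no pairs of parallel edges):
no edge has ends that stay joined when the edge is deleted. -/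
def IsAcyclic (H : Graph α β) : Prop :=
  ∀ e u v, H.IsLink e u v → ¬ Reachable (H.deleteEdges {e}) u v

/-- `T` is the edge set of a spanning tree of the multigraph `H`. -/
def IsSpanningTree (H : Graph α β) (T : Set β) : Prop :=
  T ⊆ H.edgeSet ∧ IsConnected (H.restrict T) ∧ IsAcyclic (H.restrict T)

open Classical in
/-- The generating polynomial `Γ` of the spanning trees of `H`, evaluated at `y`:
the sum over all spanning trees `T` of the product of `y e` over the edges `e` of `T`. -/
noncomputable def treePolynomial [Fintype β] (H : Graph α β) (y : β → ℝ) : ℝ :=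
  ∑ T : Finset β with IsSpanningTree H (T : Set β), ∏ e ∈ T, y e

/-- The multigraph obtained from `H` by identifying the vertex `b` with the vertex `a`.
All edges are kept, so loops and parallel edges may arise. -/
def identify [DecidableEq α] (H : Graph α β) (a b : α) : Graph α β :=
  H.map fun u => if u = b then a else u

end MultiGraph

/-! ### Payment networks

The network is a simple graph `G` on a finite vertex set. Edges are elements of `Sym2 V`, and
the two directed versions of the edges are the darts of `G`. Capacities `c` and directions `D`
are functions on `Sym2 V` of which only the values on edges of `G` are ever used. -/

namespace PaymentNetwork

variable {V : Type*} (G : SimpleGraph V)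

/-- An orientation of the edges: each edge is positive in exactly one of its directions. -/
def IsOrientation (s : G.Dart → ℤˣ) : Prop :=
  ∀ d : G.Dart, s d.symm = - s d

/-- An escrow configuration: `w d` is the amount that the tail of `d` owns on its edge. -/
def IsConfiguration (c : Sym2 V → ℝ) (w : G.Dart → ℝ) : Prop :=
  ∀ d : G.Dart, 0 ≤ w d ∧ w d + w d.symm = c d.edge

/-- A flow `f` taking `k` units from `x` to `y`: the net outflow is `k` at `x`, `-k` at `y`
and zero at every other vertex (and zero at `x` if `x = y`). -/
def IsFlow [Fintype V] [DecidableEq V] [DecidableRel G.Adj] (x y : V) (k : ℝ)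
    (f : G.Dart → ℝ) : Prop :=
  (∀ d, 0 ≤ f d) ∧
  ∀ u : V, (∑ d : G.Dart with d.fst = u, f d) - (∑ d : G.Dart with d.snd = u, f d) =
    (if u = x then k else 0) - (if u = y then k else 0)

/-- The transaction of size `k` from `x` to `y` succeeds in the configuration `w`. -/
def Succeeds [Fintype V] [DecidableEq V] [DecidableRel G.Adj] (w : G.Dart → ℝ)
    (x y : V) (k : ℝ) : Prop :=
  ∃ f : G.Dart → ℝ, IsFlow G x y k f ∧ ∀ d, f d ≤ w d

variable {G}

/-- The direction of a walk: the signed sum of the directions of its edges. -/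
def walkDirection {n : ℕ} (s : G.Dart → ℤˣ) (D : Sym2 V → Fin n → ℝ) {u v : V}
    (p : G.Walk u v) : Fin n → ℝ :=
  (p.darts.map fun d => ((s d : ℤ) : ℝ) • D d.edge).sum

variable (G)

/-- `D` is a spanning representation: a walk has direction zero exactly when it is closed, and
the directions of the edges of any spanning tree span `ℝⁿ`. -/
def IsSpanningRepresentation {n : ℕ} (s : G.Dart → ℤˣ) (D : Sym2 V → Fin n → ℝ) : Prop :=
  (∀ (u v : V) (p : G.Walk u v), walkDirection s D p = 0 ↔ u = v) ∧
  ∀ T : Set (Sym2 V), MultiGraph.IsSpanningTree (Graph.ofSimpleGraph G) T →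
    Submodule.span ℝ (D '' T) = ⊤

/-- `D` maps the edges of some spanning tree to the standard basis of `ℝⁿ`. -/
def MapsTreeToStandardBasis {n : ℕ} (D : Sym2 V → Fin n → ℝ) : Prop :=
  ∃ t : Fin n → Sym2 V,
    MultiGraph.IsSpanningTree (Graph.ofSimpleGraph G) (Set.range t) ∧
    ∀ i, D (t i) = Pi.single i 1

/-- The vector `v` corresponds to the transaction of size `k` from `x` to `y`. -/
def IsTransactionVector {n : ℕ} (s : G.Dart → ℤˣ) (D : Sym2 V → Fin n → ℝ)
    (x y : V) (k : ℝ) (v : Fin n → ℝ) : Prop :=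
  ∃ p : G.Walk x y, v = k • walkDirection s D p

section Regions

variable [Fintype V] [DecidableEq V] [DecidableRel G.Adj]

/-- The represented score of a configuration: the sum over positively directed edges. -/
def score {n : ℕ} (s : G.Dart → ℤˣ) (D : Sym2 V → Fin n → ℝ) (w : G.Dart → ℝ) : Fin n → ℝ :=
  ∑ d : G.Dart with s d = 1, w d • D d.edge

/-- The image `Z` in `ℝⁿ` of the set of all configurations. -/
def stateSpace {n : ℕ} (s : G.Dart → ℤˣ) (D : Sym2 V → Fin n → ℝ) (c : Sym2 V → ℝ) :
    Set (Fin n → ℝ) :=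
  score G s D '' {w | IsConfiguration G c w}

/-- The image in `ℝⁿ` of the set of configurations in which the transaction succeeds. -/
def successRegion {n : ℕ} (s : G.Dart → ℤˣ) (D : Sym2 V → Fin n → ℝ) (c : Sym2 V → ℝ)
    (x y : V) (k : ℝ) : Set (Fin n → ℝ) :=
  score G s D '' {w | IsConfiguration G c w ∧ Succeeds G w x y k}

/-- The image in `ℝⁿ` of the set of configurations in which the transaction fails. -/
def failureRegion {n : ℕ} (s : G.Dart → ℤˣ) (D : Sym2 V → Fin n → ℝ) (c : Sym2 V → ℝ)
    (x y : V) (k : ℝ) : Set (Fin n → ℝ) :=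
  score G s D '' {w | IsConfiguration G c w ∧ ¬ Succeeds G w x y k}

/-- The zonotope of the network: the Minkowski sum of the segments from `0` to `c e • D e`. -/
def zonotope {n : ℕ} (D : Sym2 V → Fin n → ℝ) (c : Sym2 V → ℝ) : Set (Fin n → ℝ) :=
  {z | ∃ t : Sym2 V → ℝ, (∀ e, t e ∈ Set.Icc (0 : ℝ) 1) ∧
    z = ∑ e ∈ G.edgeFinset, t e • (c e • D e)}

end Regions

end PaymentNetwork

/-! Closed walks have direction zero, so `D` is, up to orientation, the difference of a potential
`φ` on the vertices, and `v = k • (φ y - φ x)` whichever walk is used. The tree mapped to the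
standard basis makes the points `φ u` affinely independent, so a change of score determines the net
outflow at every vertex. Hence a transaction succeeds in `w` exactly when the score of `w` minus `v`
is again a score (`succeeds_iff`). Success therefore depends on the score alone, although many
configurations share a score; this gives the formula for `R`, and `F = Z \ R`.

Since `v = ± k • D s(x, y)`, translation by `v` only slides the interval allowed for the coefficient
of `D s(x, y)`. By convexity, `Z` and its translate meet exactly in the combinations whose
coefficient lies in both intervals (`band_inter_band`). The common interval has length `c s(x, y) -
k`, so `R` is a translate of the zonotope of `c'`.

For the volumes, a zonotope has volume the sum of the absolute `n × n` minors of its generators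
(`Zonotope.volume_zonotope`). For the directions `D e` such a minor is 1 on spanning trees, where
the change of basis is integral with integral inverse, and 0 on other sets of `n` edges. So the
zonotope of `b` has volume `Γ(b)`. Finally `Γ` is affine in the weight of `xy`, with slope `Γ_{x=y}`
by contraction (`treePolynomial_update`), and subtracting volumes gives that of `F`. -/

/-! ### The volume of a zonotope -/

namespace Zonotope

open MeasureTheory

/-- The Minkowski sum of the segments from `0` to `v i`, for `i` in `S`. -/
def zonotope {ι E : Type*} [AddCommMonoid E] [Module ℝ E] (v : ι → E) (S : Finset ι) : Set E :=
  {z | ∃ t : ι → ℝ, (∀ i, t i ∈ Set.Icc (0 : ℝ) 1) ∧ z = ∑ i ∈ S, t i • v i}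

section Basic

variable {ι E F : Type*} [AddCommGroup E] [Module ℝ E] [AddCommGroup F] [Module ℝ F]

theorem zonotope_eq_image (v : ι → E) (S : Finset ι) :
    zonotope v S =
      (fun t : ι → ℝ => ∑ i ∈ S, t i • v i) '' (Set.univ.pi fun _ => Set.Icc (0 : ℝ) 1) := by
  ext z
  constructor
  · rintro ⟨t, ht, rfl⟩
    exact ⟨t, fun i _ => ht i, rfl⟩
  · rintro ⟨t, ht, rfl⟩
    exact ⟨t, fun i => ht i trivial, rfl⟩

theorem convex_zonotope (v : ι → E) (S : Finset ι) : Convex ℝ (zonotope v S) := by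
  rintro _ ⟨t, ht, rfl⟩ _ ⟨r, hr, rfl⟩ a b ha hb hab
  exact ⟨fun i => a • t i + b • r i, fun i => convex_Icc 0 1 (ht i) (hr i) ha hb hab,
    by simp only [Finset.smul_sum, ← Finset.sum_add_distrib, add_smul, smul_assoc]⟩

theorem isCompact_zonotope [TopologicalSpace E] [ContinuousAdd E] [ContinuousSMul ℝ E]
    (v : ι → E) (S : Finset ι) : IsCompact (zonotope v S) := by
  rw [zonotope_eq_image]
  exact (isCompact_univ_pi fun _ => isCompact_Icc).image (by fun_prop)

theorem image_zonotope (A : E →ₗ[ℝ] F) (v : ι → E) (S : Finset ι) :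
    A '' zonotope v S = zonotope (fun i => A (v i)) S := by
  simp only [zonotope_eq_image, Set.image_image, map_sum, map_smul]

theorem zonotope_empty (v : ι → E) : zonotope v ∅ = {0} := by
  ext z
  simp only [zonotope, Finset.sum_empty, Set.mem_ofPred_eq, Set.mem_singleton_iff]
  exact ⟨fun ⟨_, _, h⟩ => h, fun h => ⟨0, by simp, h⟩⟩

/-- Peeling off one generator turns the zonotope into a sweep along a segment; the volume formula is
proved by induction on this. -/
theorem zonotope_insert [DecidableEq ι] (v : ι → E) {a : ι} {S : Finset ι} (ha : a ∉ S) :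
    zonotope v (insert a S) = {z | ∃ t ∈ Set.Icc (0 : ℝ) 1, z - t • v a ∈ zonotope v S} := by
  ext z
  constructor
  · rintro ⟨t, ht, rfl⟩
    exact ⟨t a, ht a, t, ht, by rw [Finset.sum_insert ha, add_sub_cancel_left]⟩
  · rintro ⟨r, hr, t, ht, h⟩
    refine ⟨Function.update t a r, fun i => ?_, ?_⟩
    · rcases eq_or_ne i a with rfl | hi
      · simpa using hr
      · simpa [hi] using ht i
    · rw [Finset.sum_insert ha, Function.update_self, ← sub_eq_iff_eq_add', h]
      refine Finset.sum_congr rfl fun i hi => ?_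
      rw [Function.update_of_ne (ne_of_mem_of_not_mem hi ha)]

end Basic

/-- `I` is an interval `[p, q]`, and the sweep is `[p, q + 1]`. Nonemptiness matters, since an empty
set gains no length. -/
theorem volume_segment_sweep {I : Set ℝ} (hI : IsCompact I) (hI' : Convex ℝ I)
    (hne : I.Nonempty) :
    volume {x : ℝ | ∃ t ∈ Set.Icc (0 : ℝ) 1, x - t ∈ I} = volume I + 1 := by
  have hIcc := eq_Icc_of_connected_compact ⟨hne, hI'.isPreconnected⟩ hI
  set p := sInf I
  set q := sSup I
  have hpq : p ≤ q := by
    rw [hIcc] at hne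
    exact Set.nonempty_Icc.1 hne
  have : {x : ℝ | ∃ t ∈ Set.Icc (0 : ℝ) 1, x - t ∈ I} = Set.Icc p (q + 1) := by
    ext x
    rw [hIcc]
    constructor
    · rintro ⟨t, ⟨h0, h1⟩, h2, h3⟩
      exact ⟨by linarith, by linarith⟩
    · rintro ⟨h1, h2⟩
      rcases le_total x q with h | h
      · exact ⟨0, by simp, by simpa using ⟨h1, h⟩⟩
      · exact ⟨x - q, ⟨by linarith, by linarith⟩, by simpa using hpq⟩
  rw [this, hIcc, Real.volume_Icc, Real.volume_Icc, ← ENNReal.ofReal_one,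
    ← ENNReal.ofReal_add (by linarith) zero_le_one]
  congr 1
  ring

/-- Fubini's theorem for the Minkowski sum of a convex body and a unit coordinate segment. -/
theorem volume_sweep {n : ℕ} {K : Set (Fin (n + 1) → ℝ)} (hK : IsCompact K)
    (hK' : Convex ℝ K) :
    volume {z | ∃ t ∈ Set.Icc (0 : ℝ) 1, z - t • Pi.single 0 1 ∈ K} =
      volume K + volume (Fin.tail '' K) := by
  have hcons : Continuous fun p : ℝ × (Fin n → ℝ) => (Fin.cons p.1 p.2 : Fin (n + 1) → ℝ) := by
    refine continuous_pi fun i => ?_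
    induction i using Fin.cases with
    | zero => simpa using continuous_fst
    | succ i => simpa [Function.comp_def] using (continuous_apply i).comp (continuous_snd (X := ℝ))
  -- Volume by slices parallel to the zeroth axis.
  have key : ∀ A : Set (Fin (n + 1) → ℝ), MeasurableSet A →
      volume A = ∫⁻ y : Fin n → ℝ, volume {x : ℝ | (Fin.cons x y : Fin (n + 1) → ℝ) ∈ A} := by
    intro A hA
    have h := (volume_preserving_piFinSuccAbove (fun _ : Fin (n + 1) => ℝ) 0).symm
    rw [← h.measure_preimage_equiv, Measure.volume_eq_prod,
      Measure.prod_apply_symm ((MeasurableEquiv.measurable _) hA)]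
    simp only [Set.preimage, MeasurableEquiv.piFinSuccAbove_symm_apply, Fin.insertNthEquiv_zero]
    rfl
  have htail : IsCompact (Fin.tail '' K) :=
    hK.image (continuous_pi fun i => continuous_apply i.succ)
  have hsweep : IsCompact {z | ∃ t ∈ Set.Icc (0 : ℝ) 1, z - t • Pi.single 0 1 ∈ K} := by
    have h := (isCompact_Icc (a := (0 : ℝ)) (b := 1)).prod hK
    have h' := h.image (f := fun p : ℝ × (Fin (n + 1) → ℝ) => p.2 + p.1 • Pi.single 0 1)
      (by fun_prop)
    convert h' using 1
    ext z
    constructor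
    · rintro ⟨t, ht, hz⟩
      exact ⟨(t, _), ⟨ht, hz⟩, by simp⟩
    · rintro ⟨⟨t, w⟩, ⟨ht, hw⟩, rfl⟩
      exact ⟨t, ht, by simpa using hw⟩
  rw [key _ hsweep.measurableSet, key _ hK.measurableSet,
    ← lintegral_indicator_one htail.measurableSet,
    ← lintegral_add_right _ (measurable_one.indicator htail.measurableSet)]
  refine lintegral_congr fun y => ?_
  have hsub : ∀ x t : ℝ, (Fin.cons x y : Fin (n + 1) → ℝ) - t • Pi.single 0 1 =
      Fin.cons (x - t) y := by
    intro x t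
    ext i
    induction i using Fin.cases <;> simp
  simp only [Set.mem_ofPred_eq, hsub]
  -- A slice over the shadow of `K` gains exactly length 1; every other slice stays empty. The total
  -- gain is thus the volume of the shadow.
  by_cases hy : y ∈ Fin.tail '' K
  · rw [Set.indicator_of_mem hy, Pi.one_apply]
    refine volume_segment_sweep (I := {x : ℝ | (Fin.cons x y : Fin (n + 1) → ℝ) ∈ K}) ?_ ?_ ?_
    · have himg : {x : ℝ | (Fin.cons x y : Fin (n + 1) → ℝ) ∈ K} ⊆ (fun z => z 0) '' K :=
        fun x hx => ⟨_, hx, by simp⟩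
      refine (hK.image (continuous_apply 0)).of_isClosed_subset ?_ himg
      exact hK.isClosed.preimage (hcons.comp (by fun_prop : Continuous fun x : ℝ => (x, y)))
    · intro a ha b hb r q hr hq hrq
      have h := hK' ha hb hr hq hrq
      have : r • (Fin.cons a y : Fin (n + 1) → ℝ) + q • (Fin.cons b y : Fin (n + 1) → ℝ) =
          Fin.cons (r • a + q • b) y := by
        ext i
        induction i using Fin.cases with
        | zero => simp
        | succ i => simp [← add_mul, hrq]
      rwa [this] at h
    · obtain ⟨z, hz, rfl⟩ := hy
      exact ⟨z 0, by simpa [Fin.cons_self_tail] using hz⟩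
  · have hempty : ∀ x : ℝ, (Fin.cons x y : Fin (n + 1) → ℝ) ∉ K := fun x hx =>
      hy ⟨_, hx, Fin.tail_cons _ _⟩
    simp [hempty, hy]

/-! ### Absolute determinants of subfamilies. -/

section Determinant

variable {ι : Type*} {n : ℕ}

open Classical in
/-- The absolute value of the determinant of the vectors `v i`, `i ∈ S`, for a set `S` of `n`
indices; zero if `S` does not have `n` elements. -/
noncomputable def absDet (v : ι → Fin n → ℝ) (S : Finset ι) : ℝ :=
  if h : S.card = n then
    |(Matrix.of fun j : Fin n => v ((S.equivFinOfCardEq h).symm j)).det| else 0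

/-- Reordering the rows changes the determinant only by a sign, so any enumeration of `S` may be
used. -/
theorem absDet_eq (v : ι → Fin n → ℝ) {S : Finset ι} (e : Fin n ≃ S) :
    absDet v S = |(Matrix.of fun j : Fin n => v (e j)).det| := by
  have h : S.card = n := by simpa using (Fintype.card_congr e).symm
  rw [absDet, dif_pos h]
  set f := (S.equivFinOfCardEq h).symm
  have := Matrix.abs_det_submatrix_equiv_equiv (e.trans f.symm) (Equiv.refl _)
    (Matrix.of fun j : Fin n => v (f j))
  rw [← this]
  congr 2
  ext i j
  simp

theorem absDet_nonneg (v : ι → Fin n → ℝ) (S : Finset ι) : 0 ≤ absDet v S := by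
  unfold absDet
  split_ifs <;> simp

theorem absDet_map (A : (Fin n → ℝ) →ₗ[ℝ] (Fin n → ℝ)) (v : ι → Fin n → ℝ) (S : Finset ι) :
    absDet (fun i => A (v i)) S = |LinearMap.det A| * absDet v S := by
  by_cases h : S.card = n
  · have e := (S.equivFinOfCardEq h).symm
    rw [absDet_eq _ e, absDet_eq _ e, ← abs_mul, mul_comm, ← LinearMap.det_toMatrix',
      ← Matrix.det_transpose (LinearMap.toMatrix' A), ← Matrix.det_mul]
    congr 2
    ext i j
    have h := congrFun (LinearMap.toMatrix'_mulVec A (v (e i))) j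
    simp only [Matrix.mulVec, dotProduct] at h
    simp [Matrix.mul_apply, ← h, mul_comm]
  · simp [absDet, h]

theorem absDet_smul (b : ι → ℝ) (v : ι → Fin n → ℝ) (S : Finset ι) (hb : ∀ i ∈ S, 0 ≤ b i) :
    absDet (fun i => b i • v i) S = (∏ i ∈ S, b i) * absDet v S := by
  by_cases h : S.card = n
  · have e := (S.equivFinOfCardEq h).symm
    have hp : ∏ i ∈ S, b i = ∏ j : Fin n, b (e j) := by
      rw [← Finset.prod_coe_sort S]
      exact (e.prod_comp fun i : S => b i).symm
    rw [absDet_eq _ e, absDet_eq _ e, hp,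
      ← abs_of_nonneg (Finset.prod_nonneg fun j _ => hb (e j) (e j).2), ← abs_mul,
      ← Matrix.det_mul_column]
    rfl
  · simp [absDet, h]

open Classical in
theorem absDet_insert_of_eq_zero (v : ι → Fin n → ℝ) {a : ι} (S : Finset ι)
    (hv : v a = 0) : absDet v (insert a S) = 0 := by
  by_cases h : (insert a S).card = n
  · have e := ((insert a S).equivFinOfCardEq h).symm
    rw [absDet_eq _ e, abs_eq_zero]
    refine Matrix.det_eq_zero_of_row_eq_zero (e.symm ⟨a, Finset.mem_insert_self _ _⟩) fun j => ?_
    simp [hv]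
  · simp [absDet, h]

open Classical in
-- Enumerate `a` first and expand along its row `(1, 0, …, 0)`. This is the algebraic counterpart of
-- the shadow term in `volume_sweep`.
theorem absDet_insert_of_eq_single (v : ι → Fin (n + 1) → ℝ) {a : ι} {S : Finset ι}
    (ha : a ∉ S) (hv : v a = Pi.single 0 1) :
    absDet v (insert a S) = absDet (fun i => Fin.tail (v i)) S := by
  by_cases h : S.card = n
  · have e := (S.equivFinOfCardEq h).symm
    let g : Fin (n + 1) → (insert a S : Finset ι) :=
      Fin.cons ⟨a, Finset.mem_insert_self _ _⟩ fun j => ⟨e j, Finset.mem_insert_of_mem (e j).2⟩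
    have hg : Function.Injective g := by
      refine Fin.cons_injective_iff.2 ⟨?_, ?_⟩
      · rintro ⟨j, hj⟩
        have hj' : (e j : ι) = a := Subtype.ext_iff.1 hj
        exact ha (hj' ▸ (e j).2)
      · intro i j hij
        exact e.injective (Subtype.ext (by simpa using hij))
    have hb : Function.Bijective g := by
      rw [Fintype.bijective_iff_injective_and_card]
      exact ⟨hg, by simp [ha, h]⟩
    rw [absDet_eq _ (Equiv.ofBijective g hb), absDet_eq _ e, Matrix.det_succ_row_zero,
      Fin.sum_univ_succ]
    simp only [Equiv.ofBijective_apply, Matrix.of_apply, g, Fin.cons_zero, hv, Pi.single_eq_same]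
    simp only [Fin.val_zero, pow_zero, one_mul, ne_eq, Fin.succ_ne_zero, not_false_eq_true,
      Pi.single_eq_of_ne, mul_zero, zero_mul, Finset.sum_const_zero, add_zero]
    rfl
  · rw [absDet, absDet, dif_neg h, dif_neg]
    simpa [ha] using h

end Determinant

theorem exists_linearEquiv_single {n : ℕ} {u : Fin (n + 1) → ℝ} (hu : u ≠ 0) :
    ∃ A : (Fin (n + 1) → ℝ) ≃ₗ[ℝ] (Fin (n + 1) → ℝ), A u = Pi.single 0 1 := by
  have h1 : (Pi.single 0 1 : Fin (n + 1) → ℝ) ≠ 0 := by simp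
  obtain ⟨A, hA⟩ := SeparatingDual.exists_continuousLinearEquiv_apply_eq (R := ℝ) hu h1
  exact ⟨A.toLinearEquiv, hA⟩

/-- The volume of a zonotope is the sum of the absolute values of the determinants of the
`n`-element subfamilies of its generators. -/
theorem volume_zonotope {ι : Type*} :
    ∀ (n : ℕ) (S : Finset ι) (v : ι → Fin n → ℝ),
      volume (zonotope v S) = ENNReal.ofReal (∑ T ∈ S.powersetCard n, absDet v T) := by
  classical
  intro n
  induction n with
  | zero =>
    intro S v
    have h : zonotope v S = Set.univ := by
      refine Set.eq_univ_of_forall fun z => ⟨0, by simp, Subsingleton.elim _ _⟩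
    have h' : absDet v ∅ = 1 := by simp [absDet]
    rw [h, Finset.powersetCard_zero, Finset.sum_singleton, h', ENNReal.ofReal_one, volume_pi,
      Measure.pi_of_empty _ 0]
    simp
  | succ n ihn =>
    intro S
    induction S using Finset.induction_on with
    | empty =>
      intro v
      rw [zonotope_empty, Finset.powersetCard_eq_empty.2 (by simp)]
      simp
    | insert a S ha ih =>
      intro v
      -- Subfamilies avoiding `a` account for the old zonotope, those containing `a` for the volume
      -- swept out.
      rw [Finset.powersetCard_succ_insert ha, Finset.sum_union (by
        rw [Finset.disjoint_left]
        intro T hT hT'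
        obtain ⟨U, -, rfl⟩ := Finset.mem_image.1 hT'
        exact ha ((Finset.mem_powersetCard.1 hT).1 (Finset.mem_insert_self _ _))),
        Finset.sum_image (by
        intro T hT U hU hTU
        have hT := fun h => ha ((Finset.mem_powersetCard.1 hT).1 h)
        have hU := fun h => ha ((Finset.mem_powersetCard.1 hU).1 h)
        rw [← Finset.erase_insert hT, ← Finset.erase_insert hU, hTU])]
      rcases eq_or_ne (v a) 0 with hva | hva
      · rw [Finset.sum_congr rfl fun T _ => absDet_insert_of_eq_zero v T hva,
          Finset.sum_const_zero, add_zero, ← ih v]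
        congr 1
        ext z
        simp only [zonotope_insert v ha, hva, smul_zero, sub_zero, Set.mem_ofPred_eq]
        exact ⟨fun ⟨_, _, h⟩ => h, fun h => ⟨0, by simp, h⟩⟩
      -- Volume and absolute determinants both scale by `|det A|`, so the new generator may be
      -- assumed to be the zeroth basis vector.
      · obtain ⟨A, hA⟩ := exists_linearEquiv_single hva
        have hdet : LinearMap.det (A : (Fin (n + 1) → ℝ) →ₗ[ℝ] (Fin (n + 1) → ℝ)) ≠ 0 :=
          A.isUnit_det'.ne_zero
        set w : ι → Fin (n + 1) → ℝ := fun i => A (v i) with hw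
        have hvol : volume (zonotope w (insert a S)) =
            ENNReal.ofReal (∑ T ∈ S.powersetCard (n + 1), absDet w T +
              ∑ T ∈ S.powersetCard n, absDet w (insert a T)) := by
          have hwa : w a = Pi.single 0 1 := hA
          rw [zonotope_insert w ha, hwa, volume_sweep (isCompact_zonotope w S)
            (convex_zonotope w S), ih w, ENNReal.ofReal_add
              (Finset.sum_nonneg fun T _ => absDet_nonneg w T)
              (Finset.sum_nonneg fun T _ => absDet_nonneg w _)]
          congr 1
          have htail : Fin.tail '' zonotope w S = zonotope (fun i => Fin.tail (w i)) S :=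
            image_zonotope (LinearMap.funLeft ℝ ℝ Fin.succ) w S
          rw [htail, ihn]
          congr 1
          refine Finset.sum_congr rfl fun T hT => ?_
          rw [absDet_insert_of_eq_single w (fun h => ha ((Finset.mem_powersetCard.1 hT).1 h)) hwa]
        have hscale : ∀ T, absDet w T =
            |LinearMap.det (A : (Fin (n + 1) → ℝ) →ₗ[ℝ] (Fin (n + 1) → ℝ))| * absDet v T :=
          absDet_map A.toLinearMap v
        simp only [hscale, ← Finset.mul_sum, ← mul_add] at hvol
        have himg : A.toLinearMap '' zonotope v (insert a S) = zonotope w (insert a S) :=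
          image_zonotope _ _ _
        rw [ENNReal.ofReal_mul (abs_nonneg _), ← himg, Measure.addHaar_image_linearMap] at hvol
        exact (ENNReal.mul_right_inj (by simpa using hdet) ENNReal.ofReal_ne_top).1 hvol

end Zonotope

/-! ### Spanning trees and the identification of two adjacent vertices -/

namespace MultiGraph

section SpanningTrees

variable {V : Type*} {G : SimpleGraph V} {T : Set (Sym2 V)}

theorem adj_restrict_ofSimpleGraph (hT : T ⊆ G.edgeSet) (u v : V) :
    ((Graph.ofSimpleGraph G).restrict T).Adj u v ↔ (SimpleGraph.fromEdgeSet T).Adj u v := by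
  simp only [Graph.Adj, Graph.restrict_isLink, Graph.ofSimpleGraph_isLink,
    SimpleGraph.fromEdgeSet_adj]
  constructor
  · rintro ⟨e, he, rfl, h⟩
    exact ⟨he, G.ne_of_adj h⟩
  · rintro ⟨h, -⟩
    exact ⟨_, h, rfl, hT h⟩

theorem adj_deleteEdges_restrict_ofSimpleGraph (hT : T ⊆ G.edgeSet) (e : Sym2 V) (u v : V) :
    (((Graph.ofSimpleGraph G).restrict T).deleteEdges {e}).Adj u v ↔
      (SimpleGraph.fromEdgeSet (T \ {e})).Adj u v := by
  rw [← adj_restrict_ofSimpleGraph (Set.sdiff_subset.trans hT)]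
  simp only [Graph.Adj, Graph.restrict_isLink, Graph.deleteEdges_isLink, Set.mem_sdiff]
  exact exists_congr fun _ => by tauto

theorem reachable_iff_of_adj_iff {β : Type*} {K : Graph V β} {H : SimpleGraph V}
    (h : ∀ u v, K.Adj u v ↔ H.Adj u v) (u v : V) : Reachable K u v ↔ H.Reachable u v := by
  rw [SimpleGraph.reachable_iff_reflTransGen, Reachable,
    show K.Adj = H.Adj from funext₂ fun u v => propext (h u v)]

theorem isTree_fromEdgeSet_iff [Nonempty V] :
    (SimpleGraph.fromEdgeSet T).IsTree ↔
      (∀ u v, (SimpleGraph.fromEdgeSet T).Reachable u v) ∧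
      ∀ u v, u ≠ v → s(u, v) ∈ T →
        ¬ (SimpleGraph.fromEdgeSet (T \ {s(u, v)})).Reachable u v := by
  rw [SimpleGraph.isTree_iff, SimpleGraph.connected_iff,
    SimpleGraph.isAcyclic_iff_forall_adj_isBridge]
  simp only [SimpleGraph.isBridge_iff, SimpleGraph.fromEdgeSet_adj, SimpleGraph.deleteEdges,
    ← SimpleGraph.fromEdgeSet_sdiff]
  exact and_congr ⟨fun h => h.1, fun h => ⟨h, inferInstance⟩⟩
    ⟨fun h u v huv hT => h ⟨hT, huv⟩, fun h u v huv => h u v huv.2 huv.1⟩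

/-- Edges of `G` are not loops, so `fromEdgeSet` discards nothing, and acyclicity is the statement
that every edge is a bridge. -/
theorem isSpanningTree_ofSimpleGraph_iff [Nonempty V] :
    IsSpanningTree (Graph.ofSimpleGraph G) T ↔
      T ⊆ G.edgeSet ∧ (SimpleGraph.fromEdgeSet T).IsTree := by
  refine and_congr_right fun hT => ?_
  rw [isTree_fromEdgeSet_iff]
  simp only [IsConnected, IsAcyclic, Graph.vertexSet_restrict, Graph.vertexSet_ofSimpleGraph,
    Set.univ_nonempty, true_and, Set.mem_univ, true_implies, Graph.restrict_isLink,
    Graph.ofSimpleGraph_isLink, reachable_iff_of_adj_iff (adj_restrict_ofSimpleGraph hT),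
    reachable_iff_of_adj_iff (adj_deleteEdges_restrict_ofSimpleGraph hT _)]
  refine and_congr_right fun _ => ⟨fun h u v _ huv => h _ u v ⟨huv, rfl, hT huv⟩, ?_⟩
  rintro h _ u v ⟨huv, rfl, hG⟩
  exact h u v (G.ne_of_adj hG) huv

/-- If the ends of `xy` are joined by a path outside `xy`, then some edge of the path has ends
that stay joined, through `xy`, when this edge is deleted. -/
theorem exists_reachable_insert_diff {x y : V} (hxy : x ≠ y)
    (h : (SimpleGraph.fromEdgeSet T).Reachable x y) :
    ∃ a, x ≠ a ∧ s(x, a) ∈ T ∧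
      (SimpleGraph.fromEdgeSet (insert s(x, y) (T \ {s(x, a)}))).Reachable x a := by
  obtain ⟨p, hp⟩ := h.exists_isPath
  cases p with
  | nil => exact absurd rfl hxy
  | @cons _ a _ hadj p =>
    obtain ⟨-, hx⟩ := (SimpleGraph.Walk.cons_isPath_iff _ _).1 hp
    have hadj' := (SimpleGraph.fromEdgeSet_adj _).1 hadj
    refine ⟨a, hadj'.2, hadj'.1, ?_⟩
    have h1 : (SimpleGraph.fromEdgeSet (insert s(x, y) (T \ {s(x, a)}))).Reachable x y :=
      SimpleGraph.Adj.reachable (by simp [hxy])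
    -- The rest of the path never returns to `x`, so it avoids the deleted edge `s(x, a)`.
    refine h1.trans (SimpleGraph.Reachable.symm ⟨p.transfer _ fun e he => ?_⟩)
    have heT := p.edges_subset_edgeSet he
    have hne : e ≠ s(x, a) := by
      rintro rfl
      exact hx (p.fst_mem_support_of_mem_edges he)
    simp only [SimpleGraph.edgeSet_fromEdgeSet, Set.mem_sdiff] at heT ⊢
    exact ⟨Or.inr ⟨heT.1, hne⟩, heT.2⟩

section Identify

variable [DecidableEq V] {x y : V}

/-- In a multigraph whose adjacency is that of the edges `T` after identifying `y` with `x`,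
vertices are joined exactly when they are joined by the edges `T` and the edge `xy`. -/
theorem reachable_identify_iff (hxy : x ≠ y) {K : Graph V (Sym2 V)} {π : V → V}
    (hπ : π = fun u => if u = y then x else u)
    (hK : ∀ a b, K.Adj a b ↔ ∃ u v, u ≠ v ∧ s(u, v) ∈ T ∧ π u = a ∧ π v = b) (u v : V) :
    Reachable K (π u) (π v) ↔
      (SimpleGraph.fromEdgeSet (insert s(x, y) T)).Reachable u v := by
  set H := SimpleGraph.fromEdgeSet (insert s(x, y) T) with hH
  have hxyH : H.Reachable x y :=
    SimpleGraph.Adj.reachable (by simp [hH, hxy])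
  have hfiber : ∀ a b, π a = π b → H.Reachable a b := by
    intro a b hab
    simp only [hπ] at hab
    split_ifs at hab with h1 h2 h2
    · rw [h1, h2]
    · rw [h1, ← hab]
      exact hxyH.symm
    · rw [h2, hab]
      exact hxyH
    · rw [hab]
  constructor
  · intro h
    -- The induction carries all preimages of the endpoint, since consecutive edges in the quotient
    -- may lift to edges meeting only up to the identification of `x` and `y`.
    have main : ∀ b, Reachable K (π u) b → ∀ w, π w = b → H.Reachable u w := by
      intro b hb
      induction hb with
      | refl => exact fun w hw => hfiber _ _ hw.symm
      | tail _ hadj ih =>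
        obtain ⟨p, q, hpq, hT, rfl, rfl⟩ := (hK _ _).1 hadj
        intro w hw
        have hpq' : H.Adj p q := by simp [hH, hpq, hT]
        exact (ih p rfl).trans (hpq'.reachable.trans (hfiber _ _ hw.symm))
    exact main _ h v rfl
  · intro h
    rw [SimpleGraph.reachable_iff_reflTransGen] at h
    induction h with
    | refl => exact Relation.ReflTransGen.refl
    | @tail p q _ hadj ih =>
      have hpq : s(p, q) = s(x, y) ∨ s(p, q) ∈ T := by
        simpa only [hH, SimpleGraph.fromEdgeSet_adj, Set.mem_insert_iff] using
          ((SimpleGraph.fromEdgeSet_adj _).1 hadj).1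
      rcases hpq with hpq | hpq
      · have : π p = π q := by
          rcases Sym2.eq_iff.1 hpq with ⟨rfl, rfl⟩ | ⟨rfl, rfl⟩ <;> simp [hπ]
        exact this ▸ ih
      · exact ih.tail ((hK _ _).2 ⟨p, q, H.ne_of_adj hadj, hpq, rfl, rfl⟩)

/-- Walking in the quotient amounts to walking in `T` with `xy` available for free, so both
connectivity and the bridge condition translate. -/
theorem isSpanningTree_identify_iff (hxy : G.Adj x y) :
    IsSpanningTree (identify (Graph.ofSimpleGraph G) x y) T ↔
      s(x, y) ∉ T ∧ IsSpanningTree (Graph.ofSimpleGraph G) (insert s(x, y) T) := by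
  have : Nonempty V := ⟨x⟩
  set π : V → V := fun u => if u = y then x else u with hπ
  rw [isSpanningTree_ofSimpleGraph_iff, isTree_fromEdgeSet_iff, Set.insert_subset_iff,
    IsSpanningTree]
  have hE : (identify (Graph.ofSimpleGraph G) x y).edgeSet = G.edgeSet := rfl
  have hV : ∀ F, ((identify (Graph.ofSimpleGraph G) x y).restrict F).vertexSet =
      Set.range π := fun F => Set.image_univ
  have hlink : ∀ e a b, (identify (Graph.ofSimpleGraph G) x y).IsLink e a b ↔
      ∃ u v, (e = s(u, v) ∧ e ∈ G.edgeSet) ∧ π u = a ∧ π v = b := by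
    intro e a b
    simp only [identify, Graph.map_isLink, Relation.Map, Graph.ofSimpleGraph_isLink, hπ]
  rw [hE]
  by_cases hT : T ⊆ G.edgeSet
  swap
  · tauto
  have hreach : ∀ u v, Reachable ((identify (Graph.ofSimpleGraph G) x y).restrict T) (π u) (π v) ↔
      (SimpleGraph.fromEdgeSet (insert s(x, y) T)).Reachable u v := by
    refine fun u v => reachable_identify_iff hxy.ne hπ (fun a b => ?_) u v
    simp only [Graph.Adj, Graph.restrict_isLink, hlink]
    constructor
    · rintro ⟨e, he, u, v, ⟨rfl, hG⟩, h⟩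
      exact ⟨u, v, G.ne_of_adj hG, he, h⟩
    · rintro ⟨u, v, huv, he, h⟩
      exact ⟨_, he, u, v, ⟨rfl, hT he⟩, h⟩
  have hreach' : ∀ e u v,
      Reachable (((identify (Graph.ofSimpleGraph G) x y).restrict T).deleteEdges {e}) (π u) (π v) ↔
      (SimpleGraph.fromEdgeSet (insert s(x, y) (T \ {e}))).Reachable u v := by
    refine fun e u v => reachable_identify_iff hxy.ne hπ (fun a b => ?_) u v
    simp only [Graph.Adj, Graph.restrict_isLink, Graph.deleteEdges_isLink, hlink]
    constructor
    · rintro ⟨e, ⟨he, u, v, ⟨rfl, hG⟩, h⟩, hne⟩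
      exact ⟨u, v, G.ne_of_adj hG, ⟨he, hne⟩, h⟩
    · rintro ⟨u, v, huv, he, h⟩
      exact ⟨_, ⟨he.1, u, v, ⟨rfl, hT he.1⟩, h⟩, he.2⟩
  have hacyc : IsAcyclic ((identify (Graph.ofSimpleGraph G) x y).restrict T) ↔
      ∀ u v, u ≠ v → s(u, v) ∈ T →
        ¬ (SimpleGraph.fromEdgeSet (insert s(x, y) (T \ {s(u, v)}))).Reachable u v := by
    simp only [IsAcyclic, Graph.restrict_isLink, hlink]
    constructor
    · intro h u v _ huv
      rw [← hreach']
      exact h _ _ _ ⟨huv, u, v, ⟨rfl, hT huv⟩, rfl, rfl⟩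
    · rintro h _ _ _ ⟨he, u, v, ⟨rfl, hG⟩, rfl, rfl⟩
      rw [hreach']
      exact h u v (G.ne_of_adj hG) he
  have hconn : IsConnected ((identify (Graph.ofSimpleGraph G) x y).restrict T) ↔
      ∀ u v, (SimpleGraph.fromEdgeSet (insert s(x, y) T)).Reachable u v := by
    simp only [IsConnected, hV, Set.range_nonempty, true_and, Set.forall_mem_range, hreach]
  rw [hacyc, hconn]
  constructor
  · rintro ⟨-, h1, h2⟩
    -- The edge `xy` becomes a loop after identification.
    have hxyT : s(x, y) ∉ T := fun h => h2 x y hxy.ne h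
      (SimpleGraph.Adj.reachable (by simp [hxy.ne]))
    refine ⟨hxyT, ⟨hxy, hT⟩, h1, fun u v huv huvT hr => ?_⟩
    -- The quotient condition does not test `xy` itself as a bridge: if `T` joined `x` to `y`, the
    -- first edge of a path would violate the condition instead.
    by_cases he : s(u, v) = s(x, y)
    · rw [he, Set.insert_sdiff_self_of_notMem hxyT] at hr
      have hr' : (SimpleGraph.fromEdgeSet T).Reachable x y := by
        rcases Sym2.eq_iff.1 he with ⟨rfl, rfl⟩ | ⟨rfl, rfl⟩
        exacts [hr, hr.symm]
      obtain ⟨a, hxa, ha, har⟩ := exists_reachable_insert_diff hxy.ne hr'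
      exact h2 x a hxa ha har
    · rw [Set.insert_sdiff_of_notMem _ (by simpa using Ne.symm he)] at hr
      exact h2 u v huv (huvT.resolve_left he) hr
  · rintro ⟨hxyT, -, h1, h2⟩
    refine ⟨hT, h1, fun u v huv huvT hr => h2 u v huv (Or.inr huvT) ?_⟩
    rwa [Set.insert_sdiff_of_notMem _ (by
      rw [Set.mem_singleton_iff]
      exact fun h => hxyT (h ▸ huvT))]

open Classical in
-- The index set in `treePolynomial` elaborates to a `Finset (Set β)`, consisting of coerced
-- finsets. Coercion is injective, so the sum can be re-indexed by finsets.
theorem treePolynomial_eq {α β : Type*} [Fintype β] (H : Graph α β) (c : β → ℝ) :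
    treePolynomial H c =
      ∑ T ∈ Finset.univ.filter (fun T : Finset β => IsSpanningTree H (T : Set β)),
        ∏ e ∈ T, c e := by
  unfold treePolynomial
  refine (Finset.sum_nbij (fun T : Finset β => (T : Set β)) ?_ ?_ ?_ ?_).symm
  · intro T hT
    simpa [Finset.bind_def, Finset.pure_def, Finset.mem_sup] using hT
  · exact Finset.coe_injective.injOn
  · intro T hT
    simp only [Finset.bind_def, Finset.pure_def, Finset.coe_filter, Finset.mem_sup,
      Finset.mem_univ, true_and, Finset.mem_singleton, Set.mem_ofPred_eq] at hT
    obtain ⟨⟨U, rfl⟩, hU⟩ := hT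
    exact ⟨U, by simpa using hU, rfl⟩
  · intro T _
    rw [Finset.toFinset_coe]

/-- Lowering the weight of the edge `xy` by `k` lowers the generating polynomial of the spanning
trees by `k` times the polynomial of the graph in which `x` and `y` are identified. -/
theorem treePolynomial_update [Fintype V] (hxy : G.Adj x y) (c : Sym2 V → ℝ) (k : ℝ) :
    treePolynomial (Graph.ofSimpleGraph G) c -
        treePolynomial (Graph.ofSimpleGraph G)
          (Function.update c s(x, y) (c s(x, y) - k)) =
      k * treePolynomial (identify (Graph.ofSimpleGraph G) x y) c := by
  classical
  rw [treePolynomial_eq, treePolynomial_eq, treePolynomial_eq, ← Finset.sum_sub_distrib, Finset.mul_sum]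
  -- Each product is affine in the weight of `xy`, and only trees through `xy` see the change.
  have hterm : ∀ T : Finset (Sym2 V),
      ∏ e ∈ T, c e - ∏ e ∈ T, Function.update c s(x, y) (c s(x, y) - k) e =
        if s(x, y) ∈ T then k * ∏ e ∈ T.erase s(x, y), c e else 0 := by
    intro T
    split_ifs with h
    · rw [← Finset.mul_prod_erase T _ h, ← Finset.mul_prod_erase T _ h, Function.update_self,
        Finset.prod_congr rfl fun e he => Function.update_of_ne (Finset.ne_of_mem_erase he) _ _]
      ring
    · rw [Finset.prod_update_of_notMem h, sub_self]
  rw [Finset.sum_congr rfl fun T _ => hterm T, ← Finset.sum_filter]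
  refine Finset.sum_nbij' (fun T => T.erase s(x, y)) (fun T => insert s(x, y) T) ?_ ?_ ?_ ?_ ?_
  · intro T hT
    simp only [Finset.mem_filter, Finset.mem_univ, true_and] at hT ⊢
    rw [isSpanningTree_identify_iff hxy, ← Finset.coe_insert, Finset.insert_erase hT.2]
    exact ⟨by simp, hT.1⟩
  · intro T hT
    simp only [Finset.mem_filter, Finset.mem_univ, true_and] at hT ⊢
    rw [isSpanningTree_identify_iff hxy] at hT
    rw [Finset.coe_insert]
    exact ⟨hT.2, Finset.mem_insert_self _ _⟩
  · intro T hT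
    exact Finset.insert_erase (Finset.mem_filter.1 hT).2
  · intro T hT
    rw [Finset.mem_filter, isSpanningTree_identify_iff hxy] at hT
    exact Finset.erase_insert (by simpa using hT.2.1)
  · intro T _
    rfl

end Identify

end SpanningTrees

end MultiGraph

/-! ### Potentials of spanning representations -/

/-- Differences telescope along a walk. Choosing `P` trivial shows that `f` is constant; choosing a
lattice shows integrality. -/
theorem SimpleGraph.Reachable.sub_mem {V A : Type*} [AddCommGroup A] {H : SimpleGraph V}
    (P : AddSubgroup A) (f : V → A) (hf : ∀ u w, H.Adj u w → f w - f u ∈ P) {u w : V}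
    (h : H.Reachable u w) : f w - f u ∈ P := by
  rw [SimpleGraph.reachable_iff_reflTransGen] at h
  induction h with
  | refl => simp [P.zero_mem]
  | tail _ hadj ih => simpa using P.add_mem (hf _ _ hadj) ih

namespace PaymentNetwork

section Potential

variable {V : Type*} {G : SimpleGraph V} {n : ℕ} {s : G.Dart → ℤˣ} {D : Sym2 V → Fin n → ℝ}
  {φ : V → Fin n → ℝ}

/-- The direction of every directed edge is the difference of the potentials of its ends. -/
def IsPotential (s : G.Dart → ℤˣ) (D : Sym2 V → Fin n → ℝ) (φ : V → Fin n → ℝ) : Prop :=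
  ∀ d : G.Dart, ((s d : ℤ) : ℝ) • D d.edge = φ d.snd - φ d.fst

theorem walkDirection_append (s : G.Dart → ℤˣ) (D : Sym2 V → Fin n → ℝ) {u v w : V}
    (p : G.Walk u v) (q : G.Walk v w) :
    walkDirection s D (p.append q) = walkDirection s D p + walkDirection s D q := by
  simp [walkDirection, SimpleGraph.Walk.darts_append]

theorem walkDirection_reverse (hs : IsOrientation G s) (D : Sym2 V → Fin n → ℝ) {u v : V}
    (p : G.Walk u v) : walkDirection s D p.reverse = - walkDirection s D p := by
  induction p with
  | nil => simp [walkDirection]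
  | cons h p ih =>
    rw [SimpleGraph.Walk.reverse_cons, walkDirection_append, ih]
    have h1 := hs ⟨(_, _), h⟩
    simp only [SimpleGraph.Dart.symm_mk, Prod.swap_prod_mk] at h1
    simp only [walkDirection, SimpleGraph.Walk.darts_cons, SimpleGraph.Walk.darts_nil,
      List.map_cons, List.map_nil, List.sum_cons, List.sum_nil, h1, SimpleGraph.Dart.edge_mk]
    rw [Sym2.eq_swap]
    simp

/-- Take the directions of chosen walks from a root. Going out to one end of a dart, across it, and
back from the other end is a closed walk, of direction zero. -/
theorem exists_isPotential (hG : G.Connected) (hs : IsOrientation G s)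
    (hD : IsSpanningRepresentation G s D) : ∃ φ, IsPotential s D φ := by
  obtain ⟨r⟩ := hG.nonempty
  have p : ∀ u, G.Walk r u := fun u => (hG r u).some
  refine ⟨fun u => walkDirection s D (p u), fun d => ?_⟩
  have h := (hD.1 r r (((p d.fst).append (SimpleGraph.Walk.cons d.adj .nil)).append
    (p d.snd).reverse)).2 rfl
  rw [walkDirection_append, walkDirection_append, walkDirection_reverse hs] at h
  have h1 : walkDirection s D (SimpleGraph.Walk.cons d.adj .nil) =
      ((s d : ℤ) : ℝ) • D d.edge := by
    simp [walkDirection, SimpleGraph.Dart.edge]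
  rw [h1] at h
  rw [eq_sub_iff_add_eq', ← sub_eq_zero, sub_eq_add_neg, h]

theorem IsPotential.walkDirection_eq (hφ : IsPotential s D φ) {u v : V} (p : G.Walk u v) :
    walkDirection s D p = φ v - φ u := by
  induction p with
  | nil => simp [walkDirection]
  | cons h p ih =>
    have := hφ ⟨(_, _), h⟩
    simp only [walkDirection, SimpleGraph.Walk.darts_cons, List.map_cons, List.sum_cons] at ih ⊢
    rw [ih, this]
    simp

theorem IsPotential.direction_eq_or (hφ : IsPotential s D φ) {u w : V} (h : G.Adj u w) :
    D s(u, w) = φ w - φ u ∨ D s(u, w) = -(φ w - φ u) := by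
  have := hφ ⟨(u, w), h⟩
  rcases Int.units_eq_one_or (s ⟨(u, w), h⟩) with h1 | h1 <;>
    simp only [h1, SimpleGraph.Dart.edge_mk] at this
  · left; simpa using this
  · right; rw [← this]; simp

theorem IsPotential.sub_mem (hφ : IsPotential s D φ) {T : Set (Sym2 V)} (hT : T ⊆ G.edgeSet)
    (hT' : (SimpleGraph.fromEdgeSet T).Connected) (P : AddSubgroup (Fin n → ℝ))
    (hP : ∀ e ∈ T, D e ∈ P) (u w : V) : φ w - φ u ∈ P := by
  refine (hT'.preconnected u w).sub_mem P φ fun a b hab => ?_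
  have hab' := (SimpleGraph.fromEdgeSet_adj _).1 hab
  have h := hP _ hab'.1
  rcases hφ.direction_eq_or (hT hab'.1) with h1 | h1 <;> rw [h1] at h
  · exact h
  · exact neg_mem_iff.1 h

/-- Every direction is a signed sum of directions in `T`, so any subgroup containing the latter
contains them all. Subgroups rather than subspaces keep track of integrality. -/
theorem IsPotential.direction_mem (hφ : IsPotential s D φ) {T : Set (Sym2 V)}
    (hT : T ⊆ G.edgeSet) (hT' : (SimpleGraph.fromEdgeSet T).Connected)
    (P : AddSubgroup (Fin n → ℝ)) (hP : ∀ e ∈ T, D e ∈ P) {e : Sym2 V} (he : e ∈ G.edgeSet) :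
    D e ∈ P := by
  induction e using Sym2.ind with
  | _ u w =>
    rcases hφ.direction_eq_or he with h | h <;> rw [h]
    · exact hφ.sub_mem hT hT' P hP u w
    · exact neg_mem (hφ.sub_mem hT hT' P hP u w)

theorem MapsTreeToStandardBasis.exists_tree [Nonempty V] (hD' : MapsTreeToStandardBasis G D) :
    ∃ t : Fin n → Sym2 V, (∀ i, t i ∈ G.edgeSet) ∧
      (SimpleGraph.fromEdgeSet (Set.range t)).Connected ∧ ∀ i, D (t i) = Pi.single i 1 := by
  obtain ⟨t, ht, h⟩ := hD'
  rw [MultiGraph.isSpanningTree_ofSimpleGraph_iff] at ht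
  exact ⟨t, fun i => ht.1 ⟨i, rfl⟩, ht.2.connected, h⟩

/-- Every function on the vertices is, up to a constant, a linear function of the potential. -/
theorem IsPotential.exists_dotProduct (hφ : IsPotential s D φ) [Nonempty V]
    (hD' : MapsTreeToStandardBasis G D) (h : V → ℝ) :
    ∃ a : Fin n → ℝ, ∀ u w, (φ w - φ u) ⬝ᵥ a = h w - h u := by
  obtain ⟨t, ht, hc, hb⟩ := hD'.exists_tree
  have hd : ∀ i, ∃ d : G.Dart, d.edge = t i := fun i => by
    have := ht i
    generalize t i = e at this
    induction e using Sym2.ind with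
    | _ u w => exact ⟨⟨(u, w), this⟩, rfl⟩
  choose d hd using hd
  -- Tree edge `i` has direction the `i`-th basis vector, so coordinate `i` of `a` must be the
  -- increment of `h` along it, signed by orientation.
  set a : Fin n → ℝ := fun i => ((s (d i) : ℤ) : ℝ) * (h (d i).snd - h (d i).fst) with ha
  refine ⟨a, fun u w => ?_⟩
  have hsq : ∀ i, ((s (d i) : ℤ) : ℝ) * ((s (d i) : ℤ) : ℝ) = 1 := fun i => by
    exact_mod_cast Int.units_coe_mul_self (s (d i))
  have hdart : ∀ i, (φ (d i).snd - φ (d i).fst) ⬝ᵥ a = h (d i).snd - h (d i).fst := by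
    intro i
    rw [← hφ (d i), hd, hb, smul_dotProduct, single_one_dotProduct, ha, smul_eq_mul, ← mul_assoc,
      hsq, one_mul]
  have key := (hc.preconnected u w).sub_mem (⊥ : AddSubgroup ℝ) (fun v => φ v ⬝ᵥ a - h v) ?_
  · rw [AddSubgroup.mem_bot] at key
    rw [sub_dotProduct]
    linarith
  · intro p q hpq
    obtain ⟨i, hi⟩ := ((SimpleGraph.fromEdgeSet_adj _).1 hpq).1
    have hi' := hdart i
    rw [sub_dotProduct] at hi'
    rw [AddSubgroup.mem_bot]
    rw [← hd i] at hi
    rcases SimpleGraph.dart_edge_eq_mk'_iff.1 hi with h1 | h1 <;>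
      simp only [h1] at hi' <;> linarith

/-- The potentials of the vertices are affinely independent. -/
theorem IsPotential.eq_zero_of_sum_eq_zero (hφ : IsPotential s D φ) [Fintype V] [Nonempty V]
    (hD' : MapsTreeToStandardBasis G D) {δ : V → ℝ} (h0 : ∑ u, δ u = 0)
    (h1 : ∑ u, δ u • φ u = 0) : δ = 0 := by
  classical
  funext r
  -- A functional realizing the indicator of `r` isolates the coefficient `δ r`.
  obtain ⟨a, ha⟩ := hφ.exists_dotProduct hD' (Pi.single r 1)
  have h2 : ∑ u, δ u • (φ u - φ r) = 0 := by
    simp [smul_sub, Finset.sum_sub_distrib, h1, ← Finset.sum_smul, h0]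
  have h3 := congrArg (fun z => z ⬝ᵥ a) h2
  simp only [sum_dotProduct, smul_dotProduct, ha, smul_eq_mul, zero_dotProduct, mul_sub,
    Finset.sum_sub_distrib, ← Finset.sum_mul, h0, zero_mul, sub_zero] at h3
  simpa [Pi.single_apply] using h3

end Potential

/-! ### Unimodularity: tree minors are 1, all others 0. -/

section TreeDeterminant

variable {V : Type*} [Fintype V] {G : SimpleGraph V} {n : ℕ} {s : G.Dart → ℤˣ}
  {D : Sym2 V → Fin n → ℝ} {φ : V → Fin n → ℝ}

theorem isTree_fromEdgeSet_iff_card (hn : Fintype.card V = n + 1) {T : Finset (Sym2 V)}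
    (hT : (T : Set (Sym2 V)) ⊆ G.edgeSet) :
    (SimpleGraph.fromEdgeSet (T : Set (Sym2 V))).IsTree ↔
      (SimpleGraph.fromEdgeSet (T : Set (Sym2 V))).Connected ∧ T.card = n := by
  have hE : (SimpleGraph.fromEdgeSet (T : Set (Sym2 V))).edgeSet = T := by
    rw [SimpleGraph.edgeSet_fromEdgeSet, sdiff_eq_left, Set.disjoint_left]
    exact fun e he hd => G.not_isDiag_of_mem_edgeSet (hT he) hd
  rw [SimpleGraph.isTree_iff_connected_and_card, hE, Nat.card_eq_fintype_card (α := V), hn,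
    Nat.card_coe_set_eq, Set.ncard_coe_finset, Nat.add_right_cancel_iff]

/-- The directions in `T` have integer coordinates in the basis of the reference tree, and
conversely that basis is an integral combination of them. The two integer matrices are inverse, so
the determinant is `±1`. -/
theorem IsPotential.absDet_eq_one (hφ : IsPotential s D φ) (hn : Fintype.card V = n + 1)
    (hD' : MapsTreeToStandardBasis G D) {T : Finset (Sym2 V)}
    (hT : (T : Set (Sym2 V)) ⊆ G.edgeSet)
    (hT' : (SimpleGraph.fromEdgeSet (T : Set (Sym2 V))).IsTree) : Zonotope.absDet D T = 1 := by
  have : Nonempty V := hT'.connected.nonempty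
  obtain ⟨t, ht, hc, hb⟩ := hD'.exists_tree
  have hcard := ((isTree_fromEdgeSet_iff_card hn hT).1 hT').2
  have e := (T.equivFinOfCardEq hcard).symm
  rw [Zonotope.absDet_eq _ e]
  have hint : ∀ j i, ∃ m : ℤ, (m : ℝ) = D (e j) i := by
    intro j i
    have := hφ.direction_mem (Set.range_subset_iff.2 ht) hc
      (AddSubgroup.pi Set.univ fun _ => (Int.castAddHom ℝ).range) (by
        rintro _ ⟨i, rfl⟩
        rw [hb, AddSubgroup.mem_pi]
        intro l _
        exact ⟨(Pi.single i 1 : Fin n → ℤ) l, by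
          rcases eq_or_ne l i with rfl | h <;> simp [*]⟩) (hT (e j).2)
    exact (AddSubgroup.mem_pi _).1 this i trivial
  choose M hM using hint
  have hspan : ∀ i, ∃ C : Fin n → ℤ, ∑ j, C j • D (e j) = Pi.single i 1 := by
    intro i
    have := hφ.direction_mem hT hT'.connected
      (Submodule.span ℤ (Set.range fun j => D (e j))).toAddSubgroup (by
        intro a ha
        refine Submodule.subset_span ⟨e.symm ⟨a, ha⟩, ?_⟩
        simp) (ht i)
    rw [hb] at this
    exact (Submodule.mem_span_range_iff_exists_fun ℤ).1 this
  choose C hC using hspan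
  have hmul : Matrix.of C * Matrix.of M = 1 := by
    ext i l
    have h := congrFun (hC i) l
    simp only [Finset.sum_apply, zsmul_eq_mul, Pi.mul_apply, Pi.intCast_apply, ← hM] at h
    have h' : ∑ j, C i j * M j l = (Pi.single i 1 : Fin n → ℤ) l := by
      have : (((Pi.single i 1 : Fin n → ℤ) l : ℤ) : ℝ) = (Pi.single i 1 : Fin n → ℝ) l := by
        rcases eq_or_ne l i with rfl | h <;> simp [*]
      rw [← this] at h
      exact_mod_cast h
    rw [Matrix.mul_apply, Matrix.one_apply]
    simp only [Matrix.of_apply, h', Pi.single_apply, eq_comm]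
  have hdet : IsUnit (Matrix.of M).det :=
    IsUnit.of_mul_eq_one (Matrix.of C).det (by
      rw [mul_comm, ← Matrix.det_mul, hmul, Matrix.det_one])
  have hcast : (Matrix.of fun j => D (e j)).det = ((Matrix.of M).det : ℝ) := by
    rw [Int.cast_det]
    congr 1
    ext i j
    simp [hM]
  rw [hcast, ← Int.cast_abs, Int.isUnit_iff_abs_eq.1 hdet, Int.cast_one]

/-- If `T` were disconnected, the indicator of a component would give a functional vanishing on all
directions in `T`. A nonzero determinant forces this functional to be zero, yet it separates two
vertices. -/
theorem IsPotential.isTree_of_absDet_ne_zero (hφ : IsPotential s D φ)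
    (hn : Fintype.card V = n + 1) (hD' : MapsTreeToStandardBasis G D) {T : Finset (Sym2 V)}
    (hT : (T : Set (Sym2 V)) ⊆ G.edgeSet) (h : Zonotope.absDet D T ≠ 0) :
    (SimpleGraph.fromEdgeSet (T : Set (Sym2 V))).IsTree := by
  classical
  have hcard : T.card = n := by
    by_contra hne
    exact h (dif_neg hne)
  have : Nonempty V := Fintype.card_pos_iff.1 (by omega)
  have e := (T.equivFinOfCardEq hcard).symm
  rw [Zonotope.absDet_eq _ e, ne_eq, abs_eq_zero] at h
  refine (isTree_fromEdgeSet_iff_card hn hT).2 ⟨⟨fun u w => ?_⟩, hcard⟩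
  by_contra hr
  obtain ⟨a, ha⟩ := hφ.exists_dotProduct hD' fun v =>
    if (SimpleGraph.fromEdgeSet (T : Set (Sym2 V))).Reachable u v then 1 else 0
  have ha0 : a = 0 := by
    refine Matrix.eq_zero_of_mulVec_eq_zero h ?_
    funext j
    change D (e j) ⬝ᵥ a = 0
    have he := (e j).2
    generalize (e j : Sym2 V) = d at he
    induction d using Sym2.ind with
    | _ p q =>
      have hpq : (SimpleGraph.fromEdgeSet (T : Set (Sym2 V))).Adj p q :=
        (SimpleGraph.fromEdgeSet_adj _).2 ⟨he, G.ne_of_adj (hT he)⟩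
      have hiff : (SimpleGraph.fromEdgeSet (T : Set (Sym2 V))).Reachable u p ↔
          (SimpleGraph.fromEdgeSet (T : Set (Sym2 V))).Reachable u q :=
        ⟨fun h => h.trans hpq.reachable, fun h => h.trans hpq.symm.reachable⟩
      rcases hφ.direction_eq_or (hT he) with h1 | h1 <;>
        simp [h1, ha, hiff]
  have := ha u w
  simp [ha0, hr] at this

theorem IsPotential.volume_zonotope [DecidableEq V] [DecidableRel G.Adj]
    (hφ : IsPotential s D φ) (hn : Fintype.card V = n + 1) (hD' : MapsTreeToStandardBasis G D)
    {b : Sym2 V → ℝ} (hb : ∀ e ∈ G.edgeSet, 0 ≤ b e) :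
    MeasureTheory.volume (zonotope G D b) =
      ENNReal.ofReal (MultiGraph.treePolynomial (Graph.ofSimpleGraph G) b) := by
  classical
  have : Nonempty V := Fintype.card_pos_iff.1 (by omega)
  have h := Zonotope.volume_zonotope n G.edgeFinset fun e => b e • D e
  rw [show zonotope G D b = Zonotope.zonotope (fun e => b e • D e) G.edgeFinset from rfl, h,
    MultiGraph.treePolynomial_eq]
  congr 1
  have hsub : ∀ T ∈ G.edgeFinset.powersetCard n, (T : Set (Sym2 V)) ⊆ G.edgeSet := by
    intro T hT e he
    exact SimpleGraph.mem_edgeFinset.1 ((Finset.mem_powersetCard.1 hT).1 he)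
  rw [Finset.sum_congr rfl fun T hT => Zonotope.absDet_smul b D T fun e he => hb e (hsub T hT he)]
  symm
  refine Finset.sum_subset_zero_on_sdiff ?_ ?_ ?_
  · intro T hT
    rw [Finset.mem_filter, MultiGraph.isSpanningTree_ofSimpleGraph_iff] at hT
    obtain ⟨-, h1, h2⟩ := hT
    exact Finset.mem_powersetCard.2 ⟨fun e he => SimpleGraph.mem_edgeFinset.2 (h1 he),
      ((isTree_fromEdgeSet_iff_card hn h1).1 h2).2⟩
  · intro T hT
    rw [Finset.mem_sdiff, Finset.mem_filter, MultiGraph.isSpanningTree_ofSimpleGraph_iff] at hT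
    rw [mul_eq_zero]
    by_contra! hne
    exact hT.2 ⟨Finset.mem_univ _, hsub T hT.1,
      hφ.isTree_of_absDet_ne_zero hn hD' (hsub T hT.1) hne.2⟩
  · intro T hT
    rw [Finset.mem_filter, MultiGraph.isSpanningTree_ofSimpleGraph_iff] at hT
    rw [hφ.absDet_eq_one hn hD' hT.2.1 hT.2.2, mul_one]

end TreeDeterminant

end PaymentNetwork

/-! ### The success and failure regions of a transaction -/

namespace Zonotope

section Band

variable {ι E : Type*} [AddCommGroup E] [Module ℝ E]

/-- The combinations of the vectors `D i`, `i ∈ S`, in which the coefficient of `a` lies between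
`l` and `h`, and the coefficient of every other index `i` between `0` and `c i`. -/
def band (D : ι → E) (S : Finset ι) (c : ι → ℝ) (a : ι) (l h : ℝ) : Set E :=
  {z | ∃ t : ι → ℝ, (∀ i ∈ S, i ≠ a → 0 ≤ t i ∧ t i ≤ c i) ∧ (l ≤ t a ∧ t a ≤ h) ∧
    z = ∑ i ∈ S, t i • D i}

theorem mem_zonotope_smul_iff (D : ι → E) (S : Finset ι) (c : ι → ℝ) {z : E}
    (hc : ∀ i ∈ S, 0 ≤ c i) :
    z ∈ zonotope (fun i => c i • D i) S ↔
      ∃ t : ι → ℝ, (∀ i ∈ S, 0 ≤ t i ∧ t i ≤ c i) ∧ z = ∑ i ∈ S, t i • D i := by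
  classical
  constructor
  · rintro ⟨t, ht, rfl⟩
    exact ⟨fun i => t i * c i, fun i hi => ⟨mul_nonneg (ht i).1 (hc i hi),
      mul_le_of_le_one_left (hc i hi) (ht i).2⟩, by simp only [mul_smul]⟩
  · rintro ⟨t, ht, rfl⟩
    refine ⟨fun i => if i ∈ S then t i / c i else 0, fun i => ?_,
      Finset.sum_congr rfl fun i hi => ?_⟩
    · by_cases hi : i ∈ S
      · simp only [hi, if_true]
        exact ⟨div_nonneg (ht i hi).1 (hc i hi), div_le_one_of_le₀ (ht i hi).2 (hc i hi)⟩
      · simp [hi]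
    · simp only [hi, if_true]
      -- If `c i = 0`, the bounds force `t i = 0`, so division by zero does no harm.
      rw [smul_smul, div_mul_cancel_of_imp fun h => ?_]
      linarith [(ht i hi).1, (ht i hi).2]

variable {D : ι → E} {S : Finset ι} {c : ι → ℝ} {a : ι}

/-- Two overlapping bands meet in the band of the common coefficients. -/
theorem band_inter_band {l₁ h₁ l₂ h₂ : ℝ} (hl : l₁ ≤ l₂) (hm : l₂ ≤ h₁) (hh : h₁ ≤ h₂) :
    band D S c a l₁ h₁ ∩ band D S c a l₂ h₂ = band D S c a l₂ h₁ := by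
  ext z
  constructor
  · rintro ⟨⟨t, ht, ⟨ht1, ht2⟩, hz⟩, r, hr, ⟨hr1, hr2⟩, hz'⟩
    rcases le_or_gt l₂ (t a) with h1 | h1
    · exact ⟨t, ht, ⟨h1, ht2⟩, hz⟩
    rcases le_or_gt (r a) h₁ with h2 | h2
    · exact ⟨r, hr, ⟨hr1, h2⟩, hz'⟩
    -- The two representations of `z` now have coefficients at `a` on opposite sides of `l₂`; their
    -- convex combination with coefficient exactly `l₂` still represents `z`.
    have hpos : 0 < r a - t a := by linarith
    set p := (r a - l₂) / (r a - t a) with hp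
    set q := (l₂ - t a) / (r a - t a) with hq
    have hp0 : 0 ≤ p := div_nonneg (by linarith) hpos.le
    have hq0 : 0 ≤ q := div_nonneg (by linarith) hpos.le
    have hpq : p + q = 1 := by
      rw [hp, hq, ← add_div, div_eq_one_iff_eq hpos.ne']
      ring
    have hval : p * t a + q * r a = l₂ := by
      rw [hp, hq]
      field_simp
      ring
    refine ⟨fun i => p * t i + q * r i, fun i hi hia => ?_, ?_, ?_⟩
    · exact convex_Icc 0 (c i) (ht i hi hia) (hr i hi hia) hp0 hq0 hpq
    · simp only [hval]
      exact ⟨le_rfl, hm⟩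
    · simp only [add_smul, mul_smul, Finset.sum_add_distrib, ← Finset.smul_sum, ← hz, ← hz']
      rw [← add_smul, hpq, one_smul]
  · rintro ⟨t, ht, ⟨h1, h2⟩, hz⟩
    exact ⟨⟨t, ht, ⟨hl.trans h1, h2⟩, hz⟩, t, ht, ⟨h1, h2.trans hh⟩, hz⟩

variable [DecidableEq ι]

theorem zonotope_update_eq_band (ha : a ∈ S) (hc : ∀ i ∈ S, 0 ≤ c i) {m : ℝ} (hm : 0 ≤ m) :
    zonotope (fun i => Function.update c a m i • D i) S = band D S c a 0 m := by
  ext z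
  rw [mem_zonotope_smul_iff]
  · refine exists_congr fun t => ?_
    rw [← and_assoc]
    refine and_congr_left fun _ => ⟨fun h => ⟨fun i hi hia => ?_, ?_⟩, fun h i hi => ?_⟩
    · simpa [hia] using h i hi
    · simpa using h a ha
    · rcases eq_or_ne i a with rfl | hia
      · simpa using h.2
      · simpa [hia] using h.1 i hi hia
  · intro i hi
    rcases eq_or_ne i a with rfl | hia
    · simpa using hm
    · simpa [hia] using hc i hi

theorem add_mem_band (ha : a ∈ S) {l h r : ℝ} {z : E} (hz : z ∈ band D S c a l h) :
    r • D a + z ∈ band D S c a (r + l) (r + h) := by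
  obtain ⟨t, h1, h2, rfl⟩ := hz
  refine ⟨Function.update t a (r + t a), fun i hi hia => by simpa [hia] using h1 i hi hia,
    by simpa using h2, ?_⟩
  rw [← Finset.add_sum_erase _ _ ha, ← Finset.add_sum_erase _ _ ha, Function.update_self,
    add_smul, add_assoc]
  congr 2
  exact Finset.sum_congr rfl fun i hi => by
    rw [Function.update_of_ne (Finset.ne_of_mem_erase hi)]

theorem add_mem_band_iff (ha : a ∈ S) {l h r : ℝ} {z : E} :
    r • D a + z ∈ band D S c a (r + l) (r + h) ↔ z ∈ band D S c a l h := by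
  refine ⟨fun hz => ?_, add_mem_band ha⟩
  simpa using add_mem_band (r := -r) ha hz

end Band

end Zonotope

/-! ### Flows, scores and the feasibility criterion. -/

namespace PaymentNetwork

variable {V : Type*} {G : SimpleGraph V} {n : ℕ} {s : G.Dart → ℤˣ} {D : Sym2 V → Fin n → ℝ}
  {φ : V → Fin n → ℝ} {c : Sym2 V → ℝ}

theorem IsOrientation.eq_of_edge_eq (hs : IsOrientation G s) {d d' : G.Dart} (hd : s d = 1)
    (hd' : s d' = 1) (h : d.edge = d'.edge) : d = d' := by
  rcases SimpleGraph.dart_edge_eq_iff d d' |>.1 h with h | h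
  · exact h
  · rw [h, hs, hd'] at hd
    exact absurd hd (by decide)

theorem IsOrientation.exists_edge_eq (hs : IsOrientation G s) {e : Sym2 V}
    (he : e ∈ G.edgeSet) : ∃ d : G.Dart, s d = 1 ∧ d.edge = e := by
  induction e using Sym2.ind with
  | _ u w =>
    rcases Int.units_eq_one_or (s ⟨(u, w), he⟩) with h | h
    · exact ⟨_, h, rfl⟩
    · exact ⟨SimpleGraph.Dart.symm ⟨(u, w), he⟩, by rw [hs, h, neg_neg],
        SimpleGraph.Dart.edge_symm _⟩

variable [Fintype V] [DecidableRel G.Adj]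

/-- A dart and its reverse have opposite potential differences, so they combine into the net flow on
the positive one. -/
theorem IsPotential.sum_smul_sub (hφ : IsPotential s D φ) (hs : IsOrientation G s)
    (f : G.Dart → ℝ) :
    ∑ d : G.Dart, f d • (φ d.snd - φ d.fst) =
      ∑ d : G.Dart with s d = 1, (f d - f d.symm) • D d.edge := by
  rw [← Finset.sum_filter_add_sum_filter_not _ fun d => s d = 1]
  have hneg : ∑ d : G.Dart with ¬ s d = 1, f d • (φ d.snd - φ d.fst) =
      ∑ d : G.Dart with s d = 1, -(f d.symm • D d.edge) := by
    refine Finset.sum_nbij' SimpleGraph.Dart.symm SimpleGraph.Dart.symm ?_ ?_ ?_ ?_ ?_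
    · intro d hd
      have hd' := (Int.units_eq_one_or (s d)).resolve_left (by simpa using hd)
      simp [hs d, hd']
    · intro d hd
      have hd' : s d = 1 := by simpa using hd
      simp [hs d, hd', show (-1 : ℤˣ) ≠ 1 by decide]
    · simp
    · simp
    · intro d hd
      have hd' := (Int.units_eq_one_or (s d)).resolve_left (by simpa using hd)
      rw [← hφ d, hd', SimpleGraph.Dart.symm_symm, SimpleGraph.Dart.edge_symm]
      simp
  rw [hneg, ← Finset.sum_add_distrib]
  refine Finset.sum_congr rfl fun d hd => ?_
  have hd' : s d = 1 := by simpa using hd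
  rw [← hφ d, hd', sub_smul, sub_eq_add_neg]
  simp

theorem IsOrientation.sum_edge (hs : IsOrientation G s) {E : Type*} [AddCommMonoid E]
    (F : Sym2 V → E) : ∑ d : G.Dart with s d = 1, F d.edge = ∑ e ∈ G.edgeFinset, F e := by
  refine Finset.sum_nbij SimpleGraph.Dart.edge ?_ ?_ ?_ fun _ _ => rfl
  · exact fun d _ => SimpleGraph.mem_edgeFinset.2 d.edge_mem
  · intro d hd d' hd' h
    exact hs.eq_of_edge_eq (by simpa using hd) (by simpa using hd') h
  · intro e he
    obtain ⟨d, hd, rfl⟩ := hs.exists_edge_eq (SimpleGraph.mem_edgeFinset.1 he)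
    exact ⟨d, by simpa using hd, rfl⟩

/-- A configuration amounts to a free choice in `[0, c e]` on the positive dart of each edge. -/
theorem stateSpace_eq_zonotope (hs : IsOrientation G s) (hc : ∀ e ∈ G.edgeSet, 0 ≤ c e) :
    stateSpace G s D c = zonotope G D c := by
  ext z
  rw [show zonotope G D c = Zonotope.zonotope (fun e => c e • D e) G.edgeFinset from rfl,
    Zonotope.mem_zonotope_smul_iff D _ c fun e he => hc e (SimpleGraph.mem_edgeFinset.1 he)]
  constructor
  · rintro ⟨w, hw, rfl⟩
    have hinj : Function.Injective fun d : {d : G.Dart // s d = 1} => d.1.edge :=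
      fun d d' h => Subtype.ext (hs.eq_of_edge_eq d.2 d'.2 h)
    set t : Sym2 V → ℝ :=
      Function.extend (fun d : {d : G.Dart // s d = 1} => d.1.edge) (fun d => w d.1) 0 with ht
    have htw : ∀ d : G.Dart, s d = 1 → t d.edge = w d := fun d hd =>
      hinj.extend_apply _ _ ⟨d, hd⟩
    refine ⟨t, fun e he => ?_, ?_⟩
    · obtain ⟨d, hd, rfl⟩ := hs.exists_edge_eq (SimpleGraph.mem_edgeFinset.1 he)
      rw [htw d hd]
      have h1 := hw d
      have h2 := hw d.symm
      exact ⟨h1.1, by linarith [h1.2, h2.1]⟩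
    · rw [← hs.sum_edge, score]
      exact Finset.sum_congr rfl fun d hd => by rw [htw d (by simpa using hd)]
  · rintro ⟨t, ht, rfl⟩
    refine ⟨fun d => if s d = 1 then t d.edge else c d.edge - t d.edge, fun d => ?_, ?_⟩
    · have h := ht d.edge (SimpleGraph.mem_edgeFinset.2 d.edge_mem)
      have hd' := hs d
      rcases Int.units_eq_one_or (s d) with hd | hd <;> rw [hd] at hd' <;>
        simp [hd, hd', h.1, h.2, show (-1 : ℤˣ) ≠ 1 by decide]
    · rw [← hs.sum_edge, score]
      exact Finset.sum_congr rfl fun d hd => by rw [if_pos (by simpa using hd)]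

variable [DecidableEq V]

/-- Summation by parts: the change of score caused by a flow depends only on its net outflows. -/
theorem sum_smul_sub_eq_neg_sum_net (φ : V → Fin n → ℝ) (f : G.Dart → ℝ) :
    ∑ d : G.Dart, f d • (φ d.snd - φ d.fst) =
      - ∑ u : V, ((∑ d : G.Dart with d.fst = u, f d) -
          (∑ d : G.Dart with d.snd = u, f d)) • φ u := by
  have h : ∀ g : G.Dart → V, ∑ d : G.Dart, f d • φ (g d) =
      ∑ u : V, (∑ d : G.Dart with g d = u, f d) • φ u := by
    intro g
    rw [← Finset.sum_fiberwise Finset.univ g]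
    refine Finset.sum_congr rfl fun u _ => ?_
    rw [Finset.sum_smul]
    exact Finset.sum_congr rfl fun d hd => by rw [(Finset.mem_filter.1 hd).2]
  simp only [smul_sub, sub_smul, Finset.sum_sub_distrib, neg_sub]
  rw [h fun d => d.snd, h fun d => d.fst]

theorem sum_transaction_smul (φ : V → Fin n → ℝ) (x y : V) (k : ℝ) :
    ∑ u : V, ((if u = x then k else 0) - (if u = y then k else 0)) • φ u =
      -(k • (φ y - φ x)) := by
  simp [sub_smul, Finset.sum_sub_distrib, ite_smul, smul_sub]

/-- A transaction is feasible exactly when its vector leads to a score in the state space. -/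
theorem succeeds_iff [Nonempty V] (hφ : IsPotential s D φ) (hs : IsOrientation G s)
    (hD' : MapsTreeToStandardBasis G D) {x y : V} {k : ℝ} {w : G.Dart → ℝ}
    (hw : IsConfiguration G c w) :
    Succeeds G w x y k ↔ score G s D w - k • (φ y - φ x) ∈ stateSpace G s D c := by
  constructor
  · rintro ⟨f, ⟨hf0, hf⟩, hfw⟩
    -- The configuration after executing the flow.
    refine ⟨fun d => w d - f d + f d.symm, fun d => ⟨?_, ?_⟩, ?_⟩
    · linarith [hfw d, hf0 d.symm]
    · simp only [SimpleGraph.Dart.symm_symm]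
      linarith [(hw d).2]
    · have h := hφ.sum_smul_sub hs f
      rw [sum_smul_sub_eq_neg_sum_net, Finset.sum_congr rfl fun u _ => by rw [hf u],
        sum_transaction_smul, neg_neg] at h
      rw [h, score, score, ← Finset.sum_sub_distrib]
      refine Finset.sum_congr rfl fun d _ => ?_
      rw [← sub_smul]
      congr 1
      ring
  · rintro ⟨w', hw', hscore⟩
    -- The amounts that must move to turn `w` into `w'`. They never exceed `w`, because `w'` is
    -- nonnegative.
    set f : G.Dart → ℝ := fun d => max (w d - w' d) 0 with hf
    have hdiff : ∀ d, f d - f d.symm = w d - w' d := by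
      intro d
      have h1 := (hw d).2
      have h2 := (hw' d).2
      have h3 : w d.symm - w' d.symm = -(w d - w' d) := by linarith
      simp only [hf, h3]
      rcases le_total 0 (w d - w' d) with h | h
      · rw [max_eq_left h, max_eq_right (by linarith), sub_zero]
      · rw [max_eq_right h, max_eq_left (by linarith)]
        ring
    have hsum := hφ.sum_smul_sub hs f
    have hscores : ∑ d : G.Dart with s d = 1, (f d - f d.symm) • D d.edge =
        score G s D w - score G s D w' := by
      simp only [hdiff, sub_smul, Finset.sum_sub_distrib, score]
    rw [sum_smul_sub_eq_neg_sum_net, hscores, hscore, sub_sub_cancel, neg_eq_iff_eq_neg, ← sum_transaction_smul, ← sub_eq_zero,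
      ← Finset.sum_sub_distrib] at hsum
    simp only [← sub_smul] at hsum
    -- The excess of the net outflow of `f` over the required one has total zero and annihilates
    -- `φ`, so affine independence makes `f` the desired flow.
    have hzero := hφ.eq_zero_of_sum_eq_zero hD' (by
      simp [Finset.sum_sub_distrib, Finset.sum_fiberwise]) hsum
    refine ⟨f, ⟨fun d => le_max_right _ _, fun u => ?_⟩, fun d => ?_⟩
    · exact sub_eq_zero.1 (congrFun hzero u)
    · exact max_le (by linarith [(hw' d).1]) (hw d).1

theorem successRegion_eq [Nonempty V] (hφ : IsPotential s D φ) (hs : IsOrientation G s)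
    (hD' : MapsTreeToStandardBasis G D) (c : Sym2 V → ℝ) (x y : V) (k : ℝ) :
    successRegion G s D c x y k =
      stateSpace G s D c ∩ {z | z - k • (φ y - φ x) ∈ stateSpace G s D c} := by
  ext z
  constructor
  · rintro ⟨w, ⟨hw, h⟩, rfl⟩
    exact ⟨⟨w, hw, rfl⟩, (succeeds_iff hφ hs hD' hw).1 h⟩
  · rintro ⟨⟨w, hw, rfl⟩, h⟩
    exact ⟨w, ⟨hw, (succeeds_iff hφ hs hD' hw).2 h⟩, rfl⟩

/-- Configurations with equal scores succeed or fail together, so the two regions are disjoint. -/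
theorem failureRegion_eq [Nonempty V] (hφ : IsPotential s D φ) (hs : IsOrientation G s)
    (hD' : MapsTreeToStandardBasis G D) (c : Sym2 V → ℝ) (x y : V) (k : ℝ) :
    failureRegion G s D c x y k = stateSpace G s D c \ successRegion G s D c x y k := by
  rw [successRegion_eq hφ hs hD']
  ext z
  constructor
  · rintro ⟨w, ⟨hw, h⟩, rfl⟩
    exact ⟨⟨w, hw, rfl⟩, fun h' => h ((succeeds_iff hφ hs hD' hw).2 h'.2)⟩
  · rintro ⟨⟨w, hw, rfl⟩, h⟩
    exact ⟨w, ⟨hw, fun h' => h ⟨⟨w, hw, rfl⟩, (succeeds_iff hφ hs hD' hw).1 h'⟩⟩, rfl⟩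

/-- The success region of a transaction along an edge is a translate of the zonotope of the
network with reduced capacity. -/
theorem IsPotential.successRegion_eq_image [Nonempty V] (hφ : IsPotential s D φ)
    (hs : IsOrientation G s) (hD' : MapsTreeToStandardBasis G D)
    (hc : ∀ e ∈ G.edgeSet, 0 ≤ c e) {x y : V} (hxy : G.Adj x y) {k : ℝ} (hk : 0 ≤ k)
    (hkc : k ≤ c s(x, y)) :
    successRegion G s D c x y k =
      (fun z => (if s ⟨(x, y), hxy⟩ = 1 then k • (φ y - φ x) else 0) + z) ''
        zonotope G D (Function.update c s(x, y) (c s(x, y) - k)) := by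
  have ha : s(x, y) ∈ G.edgeFinset := SimpleGraph.mem_edgeFinset.2 hxy
  have hc' : ∀ e ∈ G.edgeFinset, 0 ≤ c e := fun e he => hc e (SimpleGraph.mem_edgeFinset.1 he)
  have hZ : stateSpace G s D c =
      Zonotope.band D G.edgeFinset c s(x, y) 0 (c s(x, y)) := by
    rw [stateSpace_eq_zonotope hs hc, ← Zonotope.zonotope_update_eq_band ha hc' (hc' _ ha),
      Function.update_eq_self]
    rfl
  have hZ' : zonotope G D (Function.update c s(x, y) (c s(x, y) - k)) =
      Zonotope.band D G.edgeFinset c s(x, y) 0 (c s(x, y) - k) := by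
    rw [← Zonotope.zonotope_update_eq_band ha hc' (by linarith)]
    rfl
  rw [successRegion_eq hφ hs hD', hZ, hZ']
  have hd := hφ ⟨(x, y), hxy⟩
  simp only [SimpleGraph.Dart.edge_mk] at hd
  rw [← hd]
  rcases Int.units_eq_one_or (s ⟨(x, y), hxy⟩) with h | h
  · simp only [h, if_true, Units.val_one, Int.cast_one, one_smul]
    -- The coefficient intervals `[0, c]` and `[k, k + c]` of `xy` meet in `[k, c]`, the translate
    -- of `[0, c - k]` by `k`.
    have hshift : {z | z - k • D s(x, y) ∈
        Zonotope.band D G.edgeFinset c s(x, y) 0 (c s(x, y))} =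
        Zonotope.band D G.edgeFinset c s(x, y) k (k + c s(x, y)) := by
      ext z
      have := Zonotope.add_mem_band_iff (D := D) (c := c) (r := k) ha (l := 0)
        (h := c s(x, y)) (z := z - k • D s(x, y))
      rw [add_sub_cancel, add_zero] at this
      exact this.symm
    rw [hshift, Zonotope.band_inter_band hk hkc (by linarith)]
    ext z
    have := Zonotope.add_mem_band_iff (D := D) (c := c) (r := k) ha (l := 0)
        (h := c s(x, y) - k) (z := z - k • D s(x, y))
    rw [add_sub_cancel, add_zero, add_sub_cancel] at this
    rw [this]
    constructor
    · exact fun hz => ⟨_, hz, by simp⟩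
    · rintro ⟨z', hz', rfl⟩
      simpa using hz'
  · have hne : (-1 : ℤˣ) ≠ 1 := by decide
    -- Here the interval slides down to `[-k, c - k]`, which meets `[0, c]` in `[0, c - k]`; no
    -- translation remains.
    have hshift : {z | z - k • (((s ⟨(x, y), hxy⟩ : ℤˣ) : ℤ) : ℝ) • D s(x, y) ∈
        Zonotope.band D G.edgeFinset c s(x, y) 0 (c s(x, y))} =
        Zonotope.band D G.edgeFinset c s(x, y) (-k) (c s(x, y) - k) := by
      ext z
      have := Zonotope.add_mem_band_iff (D := D) (c := c) (r := k) ha (l := -k)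
        (h := c s(x, y) - k) (z := z)
      rw [add_neg_cancel, add_sub_cancel, add_comm] at this
      rw [← this, h]
      simp
    rw [hshift, Set.inter_comm, Zonotope.band_inter_band (by linarith) (by linarith)
      (by linarith), h, if_neg hne]
    simp

end PaymentNetwork

theorem mainTheorem4 {V : Type*} [Fintype V] [DecidableEq V]
    (G : SimpleGraph V) [DecidableRel G.Adj] (hG : G.Connected)
    (n : ℕ) (hn : Fintype.card V = n + 1)
    (s : G.Dart → ℤˣ) (hs : PaymentNetwork.IsOrientation G s)
    (D : Sym2 V → Fin n → ℝ) (hD : PaymentNetwork.IsSpanningRepresentation G s D)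
    (hD' : PaymentNetwork.MapsTreeToStandardBasis G D)
    (c : Sym2 V → ℝ) (hc : ∀ e ∈ G.edgeSet, 0 ≤ c e)
    (x y : V) (hxy : G.Adj x y) (k : ℝ) (hk : 0 ≤ k) (hkc : k ≤ c s(x, y))
    (v : Fin n → ℝ) (hv : PaymentNetwork.IsTransactionVector G s D x y k v)
    (c' : Sym2 V → ℝ) (hc' : c' = Function.update c s(x, y) (c s(x, y) - k)) :
    PaymentNetwork.successRegion G s D c x y k =
      (fun z => (if s ⟨(x, y), hxy⟩ = 1 then v else 0) + z) '' PaymentNetwork.zonotope G D c' ∧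
    PaymentNetwork.successRegion G s D c x y k =
      PaymentNetwork.stateSpace G s D c ∩ {z | z - v ∈ PaymentNetwork.stateSpace G s D c} ∧
    MeasureTheory.volume (PaymentNetwork.successRegion G s D c x y k) =
      ENNReal.ofReal (MultiGraph.treePolynomial (Graph.ofSimpleGraph G) c') ∧
    MeasureTheory.volume (PaymentNetwork.failureRegion G s D c x y k) =
      ENNReal.ofReal
        (k * MultiGraph.treePolynomial
          (MultiGraph.identify (Graph.ofSimpleGraph G) x y) c) := by
  have : Nonempty V := ⟨x⟩
  obtain ⟨φ, hφ⟩ := PaymentNetwork.exists_isPotential hG hs hD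
  obtain ⟨p, rfl⟩ := hv
  rw [hφ.walkDirection_eq p]
  have hnonneg : ∀ e ∈ G.edgeSet, 0 ≤ c' e := by
    intro e he
    rw [hc']
    rcases eq_or_ne e s(x, y) with rfl | hne
    · simpa using hkc
    · simpa [hne] using hc e he
  have hR := hφ.successRegion_eq_image hs hD' hc hxy hk hkc
  rw [← hc'] at hR
  have hR' := PaymentNetwork.successRegion_eq hφ hs hD' c x y k
  have hvol : MeasureTheory.volume (PaymentNetwork.successRegion G s D c x y k) =
      ENNReal.ofReal (MultiGraph.treePolynomial (Graph.ofSimpleGraph G) c') := by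
    rw [hR, Set.image_add_left, MeasureTheory.measure_preimage_add,
      hφ.volume_zonotope hn hD' hnonneg]
  refine ⟨hR, hR', hvol, ?_⟩
  have hmeas : MeasurableSet (PaymentNetwork.successRegion G s D c x y k) := by
    rw [hR]
    exact ((Zonotope.isCompact_zonotope _ _).image (continuous_const_add _)).measurableSet
  have hpoly : 0 ≤ MultiGraph.treePolynomial (Graph.ofSimpleGraph G) c' := by
    classical
    rw [MultiGraph.treePolynomial_eq]
    refine Finset.sum_nonneg fun T hT => Finset.prod_nonneg fun e he => hnonneg e ?_
    exact (Finset.mem_filter.1 hT).2.1 he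
  rw [PaymentNetwork.failureRegion_eq hφ hs hD', MeasureTheory.measure_sdiff
    (hR'.trans_subset Set.inter_subset_left) hmeas.nullMeasurableSet
    (by rw [hvol]; exact ENNReal.ofReal_ne_top), hvol,
    PaymentNetwork.stateSpace_eq_zonotope hs hc, hφ.volume_zonotope hn hD' hc,
    ← ENNReal.ofReal_sub _ hpoly, hc', MultiGraph.treePolynomial_update hxy]
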